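/- Let $L_1,\dots,L_n$ be lattices, $\mathit{Store}=L_1\times\dots\times L_n$ with the componentwise order, and let $P$ be a PCCP process with variables $1,\dots,n$, built by the grammar $P,Q ::= \mathtt{if}\ b\ \mathtt{then}\ P \mid x\leftarrow f(y_1,\dots,y_m)\mid P\,\|\,Q$, where $b$ is a variable whose lattice is the Booleans with $\mathit{false}\le\mathit{true}$, and $f$ is monotone. Let $G$ be the guarded normal form of $P$: the set of guarded commands $A\Rightarrow x\leftarrow f(y_1,\dots,y_m)$, one for each tell statement of $P$, with $A$ the set of the variables $b$ of the ask statements around it. *Operational semantics.* Selecting a command $A\Rightarrow x\leftarrow f(y_1,\dots,y_m)$ in a store $s$ in which all $b\in A$ are true replaces $s(x)$ by $s(x)\sqcup f(s(y_1),\dots,s(y_m))$; selecting it in a store in which some $b\in A$ is false changes nothing. An execution selects a command of $G$ at each step, and is fair if it selects each one infinitely often. We say that $\mathit{os}=(\mathbf{fix}\ \mathcal O(P))(s_1)$ is reachable in finitely many steps if some fair execution that starts in $s_1$ arrives after finitely many steps in $\mathit{os}$ and $\mathit{os}$ is a fixed point of every selection (there is at most one such $\mathit{os}$). *Load/store semantics.*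 Each command of $G$ becomes a thread which repeats the following loop: load all $b\in A$ into registers; if all of them are true, load $y_1,\dots,y_m$ and $x$ into registers $ry_1,\dots,ry_m$ and $rx$, compute $ox=rx\sqcup f(ry_1,\dots,ry_m)$, and if $ox>rx$, store (assign) $ox$ to $x$. An execution from $s_1$ is an infinite sequence of instructions of the threads with stores $s_1,s_2,\dots$ of the shared variables. It is subject to: (PO) the loads of one iteration can be executed in any order, but the test of the guards follows the loads of the guards, the test $ox>rx$ follows the loads of $x$ and the $y_k$, the assignment follows both tests, and iterations of a thread do not overlap; (ATOM) each load and each store instruction is one atomic step; (OTA) a load of $a$ at step $k$ returns $s_j(a)$ for some $j\le k$, that is, the initial value or a value stored earlier, possibly an outdated one. An execution satisfies (EC) if for every $T$, from some step on each load of a variable $a$ returns a value $s_j(a)$ with $T\le j\le k$, where $k$ is the step of the load. It satisfies (FAIR) if every thread executes infinitely many instructions. **Theorem (Completeness).** Suppose that $\mathit{os}=(\mathbf{fix}\ \mathcal O(P))(s_1)$ is reachable in finitely many steps. 1. There is a load/store execution from $s_1$ satisfying PO, ATOM, OTA, EC and FAIR, even one in which every load returns the current value, such that for some $i$ we have $s_i\ge\mathit{os}$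 and $s_j=s_i$ for all $j>i$. 2. If moreover for each variable $x$ there is no infinite strictly ascending chain in $\{v\in L_x : s_1(x)\le v\le \mathit{os}(x)\}$ (for instance if the lattices are finite or satisfy the ascending chain condition), then for every load/store execution from $s_1$ satisfying PO, ATOM, OTA, EC and FAIR there is $i$ such that $s_i\ge\mathit{os}$ and $s_j=s_i$ for all $j>i$. 3. In every load/store execution from $s_1$ satisfying PO, ATOM and OTA, $s_i\le\mathit{os}$ for all $i$; consequently, if $s_i\ge\mathit{os}$ and $s_j=s_i$ for all $j>i$, then $s_j=\mathit{os}$ for all $j\ge i$: the execution computes exactly the operational fixed point. -/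

import Mathlib

namespace PCCP

universe u

section

variable {n : ℕ}

/-- The store `L₁ × … × Lₙ`, with the componentwise order; variables are the indices `Fin n`. -/
abbrev Store (L : Fin n → Type u) : Type u := ∀ i, L i

variable (L : Fin n → Type u) [∀ i, Lattice (L i)]

/-- A variable `b` of type `BInc`, the lattice of Booleans with `false ≤ true`
(the order of Lean's `Bool`). -/
structure BoolVar where
  idx : Fin n
  iso : L idx ≃o Bool

/-- PCCP processes after local variables have been turned into indices of the store:
ask `if b then P`, tell `x ← f(y₁,…,yₘ)` with `f` monotone, and parallel composition. -/
inductive Proc : Type u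
  | ask (b : BoolVar L) (P : Proc) : Proc
  | tell (x : Fin n) (m : ℕ) (y : Fin m → Fin n) (f : (∀ k, L (y k)) →o L x) : Proc
  | par (P Q : Proc) : Proc

/-- A guarded command `{b₁,…} ⇒ x ← f(y₁,…,yₘ)`. -/
structure GCmd : Type u where
  guards : Set (BoolVar L)
  x : Fin n
  m : ℕ
  y : Fin m → Fin n
  f : (∀ k, L (y k)) →o L x

variable {L}

/-- Guarded normal form: `gnf A P` is the set of guarded commands of `P` below the guards `A`. -/
def gnf : Set (BoolVar L) → Proc L → Set (GCmd L)
  | A, .ask b P => gnf (A ∪ {b}) P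
  | A, .tell x m y f => {⟨A, x, m, y, f⟩}
  | A, .par P Q => gnf A P ∪ gnf A Q

/-! ### Operational semantics -/

/-- `embed x s v` joins `v` into the component `x` of the store. -/
def embed (x : Fin n) (s : Store L) (v : L x) : Store L :=
  Function.update s x (s x ⊔ v)

/-- All guards of the command are true in the store. -/
def GCmd.Enabled (g : GCmd L) (s : Store L) : Prop :=
  ∀ b ∈ g.guards, b.iso (s b.idx) = true

/-- The transition `⟨s, G⟩ ↪ ⟨s', G⟩` that selects the command `g`. -/
def Select (g : GCmd L) (s s' : Store L) : Prop :=
  g.Enabled s ∧ s' = embed g.x s (g.f fun k => s (g.y k))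

/-- An infinite operational execution of `G` from `s₁`. The scheduler picks one command at each
step; picking a command whose guards do not all hold leaves the store unchanged. -/
structure OpExec (G : Set (GCmd L)) (s₁ : Store L) where
  st : ℕ → Store L
  sel : ℕ → GCmd L
  init : st 0 = s₁
  sel_mem : ∀ k, sel k ∈ G
  step : ∀ k, Select (sel k) (st k) (st (k + 1)) ∨
    (¬ (sel k).Enabled (st k) ∧ st (k + 1) = st k)

/-- Fairness: every command is picked infinitely often. -/
def OpExec.Fair {G : Set (GCmd L)} {s₁ : Store L} (e : OpExec G s₁) : Prop :=
  ∀ g ∈ G, ∀ i, ∃ j, i ≤ j ∧ e.sel j = g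

/-- `s` is a fixed point of the transition `↪` of `G`. -/
def IsOpFixed (G : Set (GCmd L)) (s : Store L) : Prop :=
  ∀ g ∈ G, ∀ s', Select g s s' → s' = s

/-- `os = (fix 𝒪(P))(s₁)`, and this fixed point is reachable in finitely many steps: some fair
operational execution of `P` from `s₁` arrives after finitely many steps at `os`, a fixed point of
the transition. By `ReachesOpFix.unique` there is at most one such `os`. -/
def ReachesOpFix (P : Proc L) (s₁ os : Store L) : Prop :=
  ∃ e : OpExec (gnf ∅ P) s₁, e.Fair ∧ ∃ k, e.st k = os ∧ IsOpFixed (gnf ∅ P) os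

theorem OpExec.le_of_isOpFixed {G : Set (GCmd L)} {s₁ t : Store L} (e : OpExec G s₁)
    (h : s₁ ≤ t) (ht : IsOpFixed G t) (k : ℕ) : e.st k ≤ t := by
  induction k with
  | zero => rw [e.init]; exact h
  | succ k ih =>
    rcases e.step k with ⟨hen, hs⟩ | ⟨-, hs⟩
    · have hen' : (e.sel k).Enabled t := by
        intro b hb
        have h1 : b.iso (e.st k b.idx) ≤ b.iso (t b.idx) := b.iso.monotone (ih b.idx)
        rw [hen b hb] at h1
        exact top_le_iff.mp h1
      have h2 := congrFun (ht _ (e.sel_mem k) _ ⟨hen', rfl⟩) (e.sel k).x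
      simp only [embed, Function.update_self] at h2
      have h3 : (e.sel k).f (fun j => e.st k ((e.sel k).y j)) ≤ t (e.sel k).x :=
        ((e.sel k).f.monotone fun j => ih _).trans (sup_eq_left.mp h2)
      rw [hs, embed, update_le_iff]
      exact ⟨sup_le (ih _) h3, fun j _ => ih j⟩
    · rw [hs]; exact ih

theorem OpExec.init_le {G : Set (GCmd L)} {s₁ : Store L} (e : OpExec G s₁) (k : ℕ) :
    s₁ ≤ e.st k := by
  induction k with
  | zero => rw [e.init]
  | succ k ih =>
    rcases e.step k with ⟨-, hs⟩ | ⟨-, hs⟩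
    · rw [hs, embed, le_update_iff]
      exact ⟨(ih _).trans le_sup_left, fun j _ => ih j⟩
    · rw [hs]; exact ih

theorem ReachesOpFix.unique {P : Proc L} {s₁ os os' : Store L}
    (h : ReachesOpFix P s₁ os) (h' : ReachesOpFix P s₁ os') : os = os' := by
  obtain ⟨e, -, k, rfl, hf⟩ := h
  obtain ⟨e', -, k', rfl, hf'⟩ := h'
  exact le_antisymm (e.le_of_isOpFixed (e'.init_le k') hf' k)
    (e'.le_of_isOpFixed (e.init_le k) hf k')

/-! ### Load/store semantics

A guarded command is compiled to a thread that runs the loop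

    while true:
      load b₁,…,b_l  into rb₁,…,rb_l
      if rb₁ ∧ … ∧ rb_l:
        load y₁,…,yₘ  into ry₁,…,ryₘ
        rf := f(ry₁,…,ryₘ)
        load x into rx
        ox := rx ⊔ rf
        bx := (ox > rx)
        if bx:
          store ox into x

The instructions between the last load and the store, or the jump back to the head of the loop,
work on registers of the thread only; they are executed together with that store or jump. -/

/-- The registers that are the target of a load: one for each guard (`rb`), one for each argument
of `f` (`ry`), and `rx`. -/
inductive Reg (g : GCmd L) : Type u
  | guard (b : g.guards) : Reg g
  | arg (k : Fin g.m) : Reg g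
  | target : Reg g

/-- The shared variable that is loaded into a register. -/
abbrev Reg.loc {g : GCmd L} : Reg g → Fin n
  | .guard b => b.1.idx
  | .arg k => g.y k
  | .target => g.x

/-- The local state of a thread within one iteration of its loop: the values loaded so far in the
iteration (`none`: not loaded yet). -/
abbrev RegFile (g : GCmd L) : Type u := ∀ r : Reg g, Option (L r.loc)

/-- The state at the head of the loop. -/
def RegFile.fresh (g : GCmd L) : RegFile g := fun _ => none

/-- All guards are loaded, and `rb₁ ∧ … ∧ rb_l` is true. -/
def RegFile.Pass {g : GCmd L} (ρ : RegFile g) : Prop :=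
  ∀ b : g.guards, ∃ v : L b.1.idx, ρ (.guard b) = some v ∧ b.1.iso v = true

/-- All guards are loaded, and `rb₁ ∧ … ∧ rb_l` is false. -/
def RegFile.Fail {g : GCmd L} (ρ : RegFile g) : Prop :=
  (∀ b : g.guards, ∃ v : L b.1.idx, ρ (.guard b) = some v) ∧
    ∃ b : g.guards, ∃ v : L b.1.idx, ρ (.guard b) = some v ∧ b.1.iso v = false

/-- All operands are loaded, `rx` with the value `rx` and `ry₁,…,ryₘ` with the values `ry`. -/
def RegFile.Operands {g : GCmd L} (ρ : RegFile g) (rx : L g.x) (ry : ∀ k, L (g.y k)) : Prop :=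
  ρ .target = some rx ∧ ∀ k, ρ (.arg k) = some (ry k)

open Classical in
/-- One atomic step of the thread of `g`, changing the shared memory and the registers of the
thread, where loads read from the memory `view`. Only these program order dependencies are kept:
the loads of an iteration can be executed in any order (so loads of `y₁,…,yₘ` and of `x` may come
before the test of the guards); the test of the guards comes after the loads of the guards; the
test `ox > rx` comes after the loads of `y₁,…,yₘ` and of `x`; the store comes after both tests. -/
inductive ThreadStep (g : GCmd L) (view : Store L) :
    Store L × RegFile g → Store L × RegFile g → Prop
  /-- A load into a register that has not been loaded in this iteration. -/
  | load (s : Store L) (ρ : RegFile g) (r : Reg g) (hr : ρ r = none) :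
      ThreadStep g view (s, ρ) (s, Function.update ρ r (some (view r.loc)))
  /-- The store, which assigns `ox = rx ⊔ rf` to `x`, and ends the iteration. -/
  | store (s : Store L) (ρ : RegFile g) (rx : L g.x) (ry : ∀ k, L (g.y k))
      (hpass : ρ.Pass) (hop : ρ.Operands rx ry) (hbx : rx < rx ⊔ g.f ry) :
      ThreadStep g view (s, ρ) (Function.update s g.x (rx ⊔ g.f ry), RegFile.fresh g)
  /-- Back to the head of the loop, as the test of the guards has failed. -/
  | guardFail (s : Store L) (ρ : RegFile g) (hfail : ρ.Fail) :
      ThreadStep g view (s, ρ) (s, RegFile.fresh g)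
  /-- Back to the head of the loop, as the test `ox > rx` has failed. -/
  | noChange (s : Store L) (ρ : RegFile g) (rx : L g.x) (ry : ∀ k, L (g.y k))
      (hpass : ρ.Pass) (hop : ρ.Operands rx ry) (hbx : ¬ rx < rx ⊔ g.f ry) :
      ThreadStep g view (s, ρ) (s, RegFile.fresh g)

/-- An infinite load/store execution of the threads of `G` from the shared memory `s₁`, with all
threads at the head of their loops. At step `k` the thread `sel k` executes one instruction. It is
executed atomically, respecting the program order (`ThreadStep`). If it is a load, it returns the
value that the variable had in the memory at time `view k`; as `view k ≤ k`, this is the initial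
value or a value that some earlier store has written, never one out of thin air, but possibly an
outdated one. -/
structure LSExec (G : Set (GCmd L)) (s₁ : Store L) where
  mem : ℕ → Store L
  regs : ℕ → ∀ g : GCmd L, RegFile g
  sel : ℕ → GCmd L
  view : ℕ → ℕ
  mem_zero : mem 0 = s₁
  regs_zero : ∀ g, regs 0 g = RegFile.fresh g
  sel_mem : ∀ k, sel k ∈ G
  view_le : ∀ k, view k ≤ k
  step : ∀ k, ThreadStep (sel k) (mem (view k))
    (mem k, regs k (sel k)) (mem (k + 1), regs (k + 1) (sel k))
  regs_frame : ∀ k g, g ≠ sel k → regs (k + 1) g = regs k g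

variable {G : Set (GCmd L)} {s₁ : Store L}

/-- Eventual coherence: for every time `T`, from some step on every load returns a value that the
variable has had at time `T` or later. (At a step that is not a load, `view k` plays no role, and
can be taken to be `k`.) -/
def LSExec.EventuallyCoherent (e : LSExec G s₁) : Prop :=
  ∀ T, ∃ K, ∀ k, K ≤ k → T ≤ e.view k

/-- Every load reads the current memory. -/
def LSExec.Interleaving (e : LSExec G s₁) : Prop :=
  ∀ k, e.view k = k

/-- Fairness: every thread executes infinitely many instructions. -/
def LSExec.Fair (e : LSExec G s₁) : Prop :=
  ∀ g ∈ G, ∀ i, ∃ j, i ≤ j ∧ e.sel j = g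

/-- At time `i` the shared memory is above `os`, and it is constant from then on. -/
def LSExec.SettlesAbove (e : LSExec G s₁) (os : Store L) (i : ℕ) : Prop :=
  os ≤ e.mem i ∧ ∀ j, i < j → e.mem i = e.mem j

end

end PCCP

namespace PCCP

universe u

section

variable {n : ℕ} {L : Fin n → Type u} [∀ i, Lattice (L i)]

/-! ### Guarded commands -/

/-! Existence: run each operational selection as one uninterrupted iteration of its thread. Its
loads then see the current memory, and its end has the effect of the selection (`OpExec.toLSExec`).

Soundness: stale values still lie below `os`, and monotonicity together with `os` being a fixed
point keeps every stored value below it (`mem_and_regs_bounds`).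

Convergence: a store may overwrite a larger value, so the memory need not grow. Instead, each change
of `x` exceeds the value of `x` that its iteration loaded. Let its parent be the change that
produced the loaded value. Values increase strictly along this tree. If there were infinitely many
changes, coherence would make every change have finitely many children, so the ascending chain
condition would make the tree finite (`finite_of_parent`, `finite_changes`). Hence the memory
becomes constant. Fair threads then complete iterations on this constant memory, so it is a fixed
point (`isOpFixed_of_constant`), and every fixed point above `s₁` is above `os`. -/

theorem finite_guards_of_mem_gnf {P : Proc L} {A : Set (BoolVar L)} (hA : A.Finite)
    {g : GCmd L} (hg : g ∈ gnf A P) : g.guards.Finite := by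
  induction P generalizing A with
  | ask b P ih => exact ih (hA.union (Set.finite_singleton b)) hg
  | tell x m y f =>
    obtain rfl : g = ⟨A, x, m, y, f⟩ := hg
    exact hA
  | par P Q ihP ihQ =>
    rcases hg with hg | hg
    · exact ihP hA hg
    · exact ihQ hA hg

/-- Makes the number of unloaded registers a termination measure for an iteration. -/
theorem Reg.finite {g : GCmd L} (hg : g.guards.Finite) : Finite (Reg g) := by
  have := hg.to_subtype
  let φ : Option (g.guards ⊕ Fin g.m) → Reg g := fun o =>
    match o with
    | none => .target
    | some (.inl b) => .guard b
    | some (.inr k) => .arg k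
  refine Finite.of_surjective φ fun r => ?_
  cases r with
  | guard b => exact ⟨some (.inl b), rfl⟩
  | arg k => exact ⟨some (.inr k), rfl⟩
  | target => exact ⟨none, rfl⟩

theorem IsOpFixed.apply_le {G : Set (GCmd L)} {s : Store L} (hs : IsOpFixed G s) {g : GCmd L}
    (hg : g ∈ G) (hen : g.Enabled s) : g.f (fun k => s (g.y k)) ≤ s g.x := by
  have h := congrFun (hs g hg _ ⟨hen, rfl⟩) g.x
  simp only [embed, Function.update_self] at h
  exact sup_eq_left.mp h

theorem embed_eq_self {x : Fin n} {s : Store L} {v : L x} (h : v ≤ s x) : embed x s v = s := by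
  rw [embed, sup_eq_left.mpr h, Function.update_eq_self]

/-! ### Steps of a thread -/

/-- The registers that are not loaded yet. -/
def RegFile.unloaded {g : GCmd L} (ρ : RegFile g) : Set (Reg g) := {r | ρ r = none}

open Classical in
theorem RegFile.unloaded_update_ssubset {g : GCmd L} {ρ : RegFile g} {r : Reg g} (hr : ρ r = none)
    (v : L r.loc) : RegFile.unloaded (Function.update ρ r (some v)) ⊂ ρ.unloaded := by
  refine ⟨fun r' hr' => ?_, fun h => ?_⟩
  · rcases eq_or_ne r' r with rfl | hne
    · exact hr
    · simpa [RegFile.unloaded, hne] using hr'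
  · simpa [RegFile.unloaded] using h (show r ∈ ρ.unloaded from hr)

open Classical in
theorem ThreadStep.inversion {g : GCmd L} {view : Store L} {p q : Store L × RegFile g}
    (h : ThreadStep g view p q) :
    (∃ r, p.2 r = none ∧ q.1 = p.1 ∧ q.2 = Function.update p.2 r (some (view r.loc))) ∨
    (q.2 = RegFile.fresh g ∧ ((q.1 = p.1 ∧ p.2.Fail) ∨
      ∃ rx ry, p.2.Pass ∧ p.2.Operands rx ry ∧
        ((rx < rx ⊔ g.f ry ∧ q.1 = Function.update p.1 g.x (rx ⊔ g.f ry)) ∨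
          (¬ rx < rx ⊔ g.f ry ∧ q.1 = p.1)))) := by
  cases h with
  | load s ρ r hr => exact .inl ⟨r, hr, rfl, rfl⟩
  | store s ρ rx ry hp ho hb => exact .inr ⟨rfl, .inr ⟨rx, ry, hp, ho, .inl ⟨hb, rfl⟩⟩⟩
  | guardFail s ρ hf => exact .inr ⟨rfl, .inl ⟨rfl, hf⟩⟩
  | noChange s ρ rx ry hp ho hb => exact .inr ⟨rfl, .inr ⟨rx, ry, hp, ho, .inr ⟨hb, rfl⟩⟩⟩

open Classical in
/-- A register that is loaded after a step holds a value that it held before, or the value that the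
step has loaded. -/
theorem ThreadStep.eq_some {g : GCmd L} {view : Store L} {p q : Store L × RegFile g}
    (h : ThreadStep g view p q) {r : Reg g} {v : L r.loc} (hv : q.2 r = some v) :
    p.2 r = some v ∨ (p.2 r = none ∧ v = view r.loc) := by
  rcases h.inversion with ⟨r', hr', -, hq⟩ | ⟨hq, -⟩
  · rw [hq] at hv
    rcases eq_or_ne r r' with rfl | hne
    · rw [Function.update_self] at hv
      exact .inr ⟨hr', (Option.some.inj hv).symm⟩
    · rw [Function.update_of_ne hne] at hv
      exact .inl hv
  · rw [hq] at hv
    cases hv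

/-- If all registers are loaded with the values of the store, the thread can end its iteration, with
the effect of an operational selection of its command. -/
theorem ThreadStep.of_loaded {g : GCmd L} (view : Store L) {s s' : Store L} {ρ : RegFile g}
    (hρ : ∀ r, ρ r = some (s r.loc))
    (hs : Select g s s' ∨ (¬ g.Enabled s ∧ s' = s)) :
    ThreadStep g view (s, ρ) (s', RegFile.fresh g) := by
  rcases hs with ⟨hen, rfl⟩ | ⟨hen, rfl⟩
  · have hpass : ρ.Pass := fun b => ⟨_, hρ (.guard b), hen b.1 b.2⟩
    have hop : ρ.Operands (s g.x) (fun k => s (g.y k)) := ⟨hρ .target, fun k => hρ (.arg k)⟩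
    by_cases hlt : s g.x < s g.x ⊔ g.f fun k => s (g.y k)
    · exact .store s ρ _ _ hpass hop hlt
    · rw [embed_eq_self (not_not.mp fun h => hlt (left_lt_sup.mpr h))]
      exact .noChange s ρ _ _ hpass hop hlt
  · refine .guardFail _ ρ ⟨fun b => ⟨_, hρ (.guard b)⟩, ?_⟩
    simp only [GCmd.Enabled, not_forall] at hen
    obtain ⟨b, hb, h⟩ := hen
    exact ⟨⟨b, hb⟩, _, hρ (.guard ⟨b, hb⟩), Bool.eq_false_of_not_eq_true h⟩

variable {G : Set (GCmd L)} {s₁ os : Store L}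

namespace LSExec

/-- The registers of a thread after a step hold values that they held before, or the value that the
step has loaded. -/
theorem regs_succ_eq_some (e : LSExec G s₁) {k : ℕ} {g : GCmd L} {r : Reg g} {v : L r.loc}
    (hv : e.regs (k + 1) g r = some v) :
    e.regs k g r = some v ∨ (e.sel k = g ∧ e.regs k g r = none ∧ v = e.mem (e.view k) r.loc) := by
  by_cases hg : g = e.sel k
  · subst hg
    rcases (e.step k).eq_some hv with h | h
    · exact .inl h
    · exact .inr ⟨rfl, h⟩
  · rw [e.regs_frame k g hg] at hv
    exact .inl hv

/-! ### Soundness -/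

/-- The induction must carry all earlier memories, since a load may read any of them, and the
registers, which keep loaded values until the store. -/
theorem mem_and_regs_bounds (e : LSExec G s₁) (h : s₁ ≤ os) (hos : IsOpFixed G os) (k : ℕ) :
    (∀ j ≤ k, e.mem j ∈ Set.Icc s₁ os) ∧
      ∀ g r v, e.regs k g r = some v → v ∈ Set.Icc (s₁ r.loc) (os r.loc) := by
  induction k with
  | zero =>
    refine ⟨fun j hj => ?_, fun g r v hv => ?_⟩
    · obtain rfl : j = 0 := by omega
      rw [e.mem_zero]
      exact ⟨le_rfl, h⟩
    · rw [e.regs_zero] at hv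
      cases hv
  | succ k ih =>
    obtain ⟨ihm, ihr⟩ := ih
    refine ⟨fun j hj => ?_, fun g r v hv => ?_⟩
    · rcases Nat.le_succ_iff.mp hj with hj | rfl
      · exact ihm j hj
      have hk := ihm k le_rfl
      rcases (e.step k).inversion with ⟨r, -, hm, -⟩ |
        ⟨-, ⟨hm, -⟩ | ⟨rx, ry, hpass, ⟨hrx, hry⟩, ⟨hlt, hm⟩ | ⟨-, hm⟩⟩⟩ <;> dsimp only at hm
      · rwa [hm]
      · rwa [hm]
      -- Guards that were true when loaded are true in the larger `os`, so the fixed point property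
      -- bounds `f` there.
      · have hen : (e.sel k).Enabled os := by
          intro b hb
          obtain ⟨v, hv, hbv⟩ := hpass ⟨b, hb⟩
          have h1 : b.iso v ≤ b.iso (os b.idx) := b.iso.monotone (ihr _ _ _ hv).2
          rw [hbv] at h1
          exact top_le_iff.mp h1
        have hf : (e.sel k).f ry ≤ os (e.sel k).x :=
          ((e.sel k).f.monotone fun j => (ihr _ _ _ (hry j)).2).trans
            (hos.apply_le (e.sel_mem k) hen)
        have hx := ihr _ _ _ hrx
        rw [hm, Set.mem_Icc, le_update_iff, update_le_iff]
        exact ⟨⟨hx.1.trans le_sup_left, fun j _ => hk.1 j⟩, sup_le hx.2 hf, fun j _ => hk.2 j⟩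
      · rwa [hm]
    · rcases e.regs_succ_eq_some hv with hv | ⟨-, -, rfl⟩
      · exact ihr g r v hv
      · have := ihm _ (e.view_le k)
        exact ⟨this.1 _, this.2 _⟩

theorem mem_mem_Icc (e : LSExec G s₁) (h : s₁ ≤ os) (hos : IsOpFixed G os) (k : ℕ) :
    e.mem k ∈ Set.Icc s₁ os :=
  (e.mem_and_regs_bounds h hos k).1 k le_rfl

/-! ### Termination of the stores -/

/-- A loaded register has been loaded by an earlier step of the current iteration. -/
theorem exists_load (e : LSExec G s₁) {k : ℕ} {g : GCmd L} {r : Reg g} {v : L r.loc}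
    (hv : e.regs k g r = some v) :
    ∃ l < k, e.sel l = g ∧ v = e.mem (e.view l) r.loc ∧
      ∀ i, l < i → i ≤ k → e.regs i g r ≠ none := by
  induction k generalizing v with
  | zero =>
    rw [e.regs_zero] at hv
    cases hv
  | succ k ih =>
    rcases e.regs_succ_eq_some hv with h | ⟨hs, -, hw⟩
    · obtain ⟨l, hl, h1, h2, h3⟩ := ih h
      refine ⟨l, by omega, h1, h2, fun i hi hik => ?_⟩
      rcases Nat.le_succ_iff.mp hik with hik | rfl
      · exact h3 i hi hik
      · simp [hv]
    · refine ⟨k, by omega, hs, hw, fun i hi hik => ?_⟩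
      obtain rfl : i = k + 1 := by omega
      simp [hv]

/-- A step that changes `x` writes a value greater than the one its thread has loaded from `x` in the
same iteration, and ends that iteration. -/
theorem exists_load_of_mem_ne (e : LSExec G s₁) {k : ℕ} {x : Fin n}
    (hx : e.mem (k + 1) x ≠ e.mem k x) :
    ∃ l < k, e.mem (e.view l) x < e.mem (k + 1) x ∧ e.sel l = e.sel k ∧
      e.regs (k + 1) (e.sel k) .target = none ∧
      ∀ i, l < i → i ≤ k → e.regs i (e.sel k) .target ≠ none := by
  rcases (e.step k).inversion with ⟨r, -, hm, -⟩ |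
    ⟨hq, ⟨hm, -⟩ | ⟨rx, ry, -, ⟨hrx, -⟩, ⟨hlt, hm⟩ | ⟨-, hm⟩⟩⟩ <;> dsimp only at hm
  · exact absurd (congrFun hm x) hx
  · exact absurd (congrFun hm x) hx
  · obtain rfl : x = (e.sel k).x := by
      by_contra hne
      rw [hm, Function.update_of_ne hne] at hx
      exact hx rfl
    obtain ⟨l, hl, hs, hv, h⟩ := e.exists_load hrx
    refine ⟨l, hl, ?_, hs, congrFun hq _, h⟩
    rw [hm, Function.update_self]
    exact hv ▸ hlt
  · exact absurd (congrFun hm x) hx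

end LSExec

/-- A set of numbers with a finitely branching parent relation that decreases a value is finite, if
there are no infinite ascending chains of values. -/
theorem finite_of_parent {α : Type*} [Preorder α] [WellFoundedGT α] {E : Set ℕ} {p : ℕ → ℕ}
    {val : ℕ → α} (hp : ∀ t ∈ E, p t < t) (hpE : ∀ t ∈ E, p t ∈ E ∨ p t = 0)
    (hval : ∀ t ∈ E, val (p t) < val t) (hfin : ∀ i, {t ∈ E | p t = i}.Finite) : E.Finite := by
  let R : ℕ → ℕ → Prop := fun a b => b ∈ E ∧ p b = a
  -- The descendants of `i` are `i` and those of its finitely many children, whose values are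
  -- greater.
  have hdesc : ∀ a : α, ∀ i, val i = a → {t | Relation.ReflTransGen R i t}.Finite := by
    intro a
    induction a using WellFoundedGT.induction with
    | ind a ih =>
      rintro i rfl
      refine ((Set.finite_singleton i).union ((hfin i).biUnion (t := fun c =>
        {t | Relation.ReflTransGen R c t}) fun c hc => ih (val c) ?_ c rfl)).subset fun t ht => ?_
      · have := hval c hc.1
        rwa [hc.2] at this
      · rcases Relation.ReflTransGen.cases_head ht with rfl | ⟨c, hc, hct⟩
        · exact .inl rfl
        · exact .inr (Set.mem_biUnion (show c ∈ {t ∈ E | p t = i} from hc) hct)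
  -- Parents are smaller numbers, so every element of `E` descends from `0`.
  refine (hdesc _ 0 rfl).subset fun t ht => ?_
  induction t using Nat.strong_induction_on with
  | _ t ih =>
    refine Relation.ReflTransGen.tail (b := p t) ?_ ⟨ht, rfl⟩
    rcases hpE t ht with h | h
    · exact ih _ (hp t ht) h
    · rw [h]

/-- The last change of a sequence up to a given time; `0` if there is none. -/
theorem exists_last_change {α : Type*} (f : ℕ → α) (j : ℕ) :
    ∃ i ≤ j, f i = f j ∧ (f i ≠ f (i - 1) ∨ i = 0) ∧ ∀ t, i < t → t ≤ j → f t = f (t - 1) := by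
  induction j with
  | zero => exact ⟨0, le_rfl, rfl, .inr rfl, fun t h1 h2 => by omega⟩
  | succ j ih =>
    by_cases h : f (j + 1) = f j
    · obtain ⟨i, hij, hf, hi, ht⟩ := ih
      refine ⟨i, by omega, hf.trans h.symm, hi, fun t h1 h2 => ?_⟩
      rcases Nat.le_succ_iff.mp h2 with h2 | rfl
      · exact ht t h1 h2
      · exact h
    · exact ⟨j + 1, le_rfl, rfl, .inl h, fun t h1 h2 => by omega⟩

namespace LSExec

theorem finite_changes (e : LSExec G s₁) (h : s₁ ≤ os) (hos : IsOpFixed G os) (x : Fin n)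
    (hwf : WellFoundedGT (Set.Icc (s₁ x) (os x))) (hec : e.EventuallyCoherent) :
    {t | e.mem t x ≠ e.mem (t - 1) x}.Finite := by
  set E := {t | e.mem t x ≠ e.mem (t - 1) x}
  by_contra hinf
  -- Time `0` is not a change, because `0 - 1 = 0`.
  have hpos : ∀ t ∈ E, t - 1 + 1 = t := by
    intro t ht
    rcases Nat.eq_zero_or_pos t with rfl | h0
    · exact absurd rfl ht
    · omega
  have hload : ∀ t, ∃ l, t ∈ E → l < t - 1 ∧ e.mem (e.view l) x < e.mem t x ∧
      e.sel l = e.sel (t - 1) ∧ e.regs t (e.sel (t - 1)) .target = none ∧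
      ∀ i, l < i → i ≤ t - 1 → e.regs i (e.sel (t - 1)) .target ≠ none := by
    intro t
    by_cases ht : t ∈ E
    · obtain ⟨k, rfl⟩ : ∃ k, t = k + 1 := ⟨t - 1, (hpos t ht).symm⟩
      obtain ⟨l, hl⟩ := e.exists_load_of_mem_ne (k := k) (x := x) ht
      exact ⟨l, fun _ => hl⟩
    · exact ⟨0, fun h => absurd h ht⟩
  choose l hl using hload
  choose c hcle hcval hcE hclast using exists_last_change fun t => e.mem t x
  -- Distinct changes belong to distinct iterations: the earlier one empties the target register,
  -- which a shared load would require to stay filled until the later one.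
  have hinj : Set.InjOn l E := by
    have key : ∀ t ∈ E, ∀ t' ∈ E, t < t' → l t ≠ l t' := by
      intro t ht t' ht' hlt heq
      obtain ⟨h1, -, h3, h4, -⟩ := hl t ht
      obtain ⟨-, -, h3', -, h5'⟩ := hl t' ht'
      have h6 := h5' t (by omega) (by omega)
      rw [← h3', ← heq, h3] at h6
      exact h6 h4
    intro t ht t' ht' heq
    rcases lt_trichotomy t t' with h | h | h
    · exact absurd heq (key t ht t' ht' h)
    · exact h
    · exact absurd heq.symm (key t' ht' t ht h)
  refine hinf (finite_of_parent (E := E) (p := fun t => c (e.view (l t)))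
    (val := fun t => (⟨e.mem t x, (e.mem_mem_Icc h hos t).1 x, (e.mem_mem_Icc h hos t).2 x⟩ :
      Set.Icc (s₁ x) (os x))) (fun t ht => ?_) (fun t _ => hcE _) (fun t ht => ?_) fun i => ?_)
  · have h1 := hcle (e.view (l t))
    have h2 := e.view_le (l t)
    have h3 := (hl t ht).1
    omega
  · rw [← Subtype.coe_lt_coe]
    exact (hcval _).trans_lt (hl t ht).2.1
  -- Finite branching: take a change `T` after `i`. Loads from step `K` on see time `T` or later, so
  -- their last change is not `i`; children of `i` thus load before `K`, and `l` is injective.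
  · obtain ⟨T, hTE, hiT⟩ := Set.Infinite.exists_gt hinf i
    obtain ⟨K, hK⟩ := hec T
    refine Set.Finite.of_finite_image ((Set.finite_lt_nat K).subset ?_)
      (hinj.mono fun t ht => ht.1)
    rintro - ⟨t, ⟨htE, rfl⟩, rfl⟩
    by_contra hlt
    exact hTE (hclast _ T hiT (hK _ (not_lt.mp hlt)))

theorem eventually_constant (e : LSExec G s₁) (h : s₁ ≤ os) (hos : IsOpFixed G os)
    (hwf : ∀ x, WellFoundedGT (Set.Icc (s₁ x) (os x))) (hec : e.EventuallyCoherent) :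
    ∃ K, ∀ k, K ≤ k → e.mem k = e.mem K := by
  choose B hB using fun x => (e.finite_changes h hos x (hwf x) hec).bddAbove
  refine ⟨Finset.univ.sup B, fun k hk => ?_⟩
  induction k, hk using Nat.le_induction with
  | base => rfl
  | succ k hk ih =>
    rw [← ih]
    funext x
    by_contra hne
    have h1 : k + 1 ≤ B x := hB x (show e.mem (k + 1) x ≠ e.mem (k + 1 - 1) x from hne)
    have h2 : B x ≤ Finset.univ.sup B := Finset.le_sup (Finset.mem_univ x)
    omega

/-! ### Progress -/

/-- In a fair execution, every thread ends iterations again and again. -/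
theorem exists_iteration_end (e : LSExec G s₁) (hfair : e.Fair) {g : GCmd L} (hg : g ∈ G)
    (hgf : g.guards.Finite) (k : ℕ) :
    ∃ j, k ≤ j ∧ e.sel j = g ∧ e.regs (j + 1) g = RegFile.fresh g := by
  have := Reg.finite hgf
  induction hc : (e.regs k g).unloaded.ncard using Nat.strong_induction_on generalizing k with
  | _ c ih =>
    classical
    have hex : ∃ j, k ≤ j ∧ e.sel j = g := hfair g hg k
    let j := Nat.find hex
    -- At the first turn of `g` from `k` on, its registers are still those of time `k`; the turn
    -- either loads one more or ends the iteration.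
    obtain ⟨hkj, hj⟩ : k ≤ j ∧ e.sel j = g := Nat.find_spec hex
    have hregs : ∀ i, k ≤ i → i ≤ j → e.regs i g = e.regs k g := by
      intro i hi
      induction i, hi using Nat.le_induction with
      | base => exact fun _ => rfl
      | succ i hi ih' =>
        intro hij
        rw [e.regs_frame i g fun h => Nat.find_min hex hij ⟨hi, h.symm⟩]
        exact ih' (by omega)
    have hstep := (e.step j).inversion
    rw [hj] at hstep
    rcases hstep with ⟨r, hr, -, hq⟩ | ⟨hq, -⟩ <;> dsimp only at hq
    · have hlt : (e.regs (j + 1) g).unloaded.ncard < c := by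
        rw [← hc, ← hregs j hkj le_rfl, hq]
        refine Set.ncard_lt_ncard ?_ (Set.toFinite _)
        convert RegFile.unloaded_update_ssubset hr _
      obtain ⟨i, hi, h⟩ := ih _ hlt (j + 1) rfl
      exact ⟨i, by omega, h⟩
    · exact ⟨j, hkj, hj, hq⟩

open Classical in
/-- If the memory is constant from some time on, then it is a fixed point of the transition. -/
theorem isOpFixed_of_constant (e : LSExec G s₁) (hG : ∀ g ∈ G, g.guards.Finite)
    (hec : e.EventuallyCoherent) (hfair : e.Fair) {K : ℕ}
    (hK : ∀ k, K ≤ k → e.mem k = e.mem K) : IsOpFixed G (e.mem K) := by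
  rintro g hg _ ⟨hen, rfl⟩
  obtain ⟨T, hT⟩ := hec K
  -- Ending one iteration discards outdated registers; all later loads return the final values.
  obtain ⟨i, hi, -, hfresh⟩ := e.exists_iteration_end hfair hg (hG g hg) (max K T)
  have hregs : ∀ k, i + 1 ≤ k → ∀ r v, e.regs k g r = some v → v = e.mem K r.loc := by
    intro k hk
    induction k, hk using Nat.le_induction with
    | base =>
      intro r v hv
      rw [hfresh] at hv
      cases hv
    | succ k hk ih =>
      intro r v hv
      rcases e.regs_succ_eq_some hv with h | ⟨-, -, h⟩
      · exact ih r v h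
      · rw [h, hK _ (hT k (by omega))]
  -- This iteration cannot fail its guards, nor store, as that would change `x`. So its test `ox >
  -- rx` fails, which is the claim.
  obtain ⟨j, hj, hsel, hend⟩ := e.exists_iteration_end hfair hg (hG g hg) (i + 1)
  have hstep := (e.step j).inversion
  rw [hsel] at hstep
  have hval := hregs j hj
  rcases hstep with ⟨r, -, -, hq⟩ | ⟨-, ⟨-, -, b, v, hv, hb⟩ | ⟨rx, ry, -, ⟨hrx, hry⟩, hm⟩⟩
  · have h := congrFun (hend.symm.trans hq) r
    rw [Function.update_self] at h
    cases h
  · have h : v = _ := hval _ _ hv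
    rw [h, hen b.1 b.2] at hb
    cases hb
  · obtain rfl : rx = _ := hval _ _ hrx
    obtain rfl : ry = fun k => e.mem K (g.y k) := funext fun k => hval _ _ (hry k)
    rcases hm with ⟨hlt, hm⟩ | ⟨hlt, -⟩
    · dsimp only at hm
      rw [hK j (by omega), hK (j + 1) (by omega)] at hm
      have h := congrFun hm g.x
      rw [Function.update_self] at h
      exact absurd h hlt.ne
    · exact embed_eq_self (not_not.mp fun h => hlt (left_lt_sup.mpr h))

end LSExec

/-! ### Simulation of the operational semantics -/

namespace OpExec

variable (e : OpExec G s₁)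

open Classical in
/-- One instruction of the simulation of an operational execution, which runs one iteration of the
thread of the selected command at a time. A state consists of the number of completed iterations,
and the registers. -/
noncomputable def simStep (c : ℕ × ∀ g : GCmd L, RegFile g) : ℕ × ∀ g : GCmd L, RegFile g :=
  if h : ∃ r, c.2 (e.sel c.1) r = none then
    (c.1, Function.update c.2 (e.sel c.1)
      (Function.update (c.2 (e.sel c.1)) h.choose (some (e.st c.1 h.choose.loc))))
  else (c.1 + 1, Function.update c.2 (e.sel c.1) (RegFile.fresh _))

/-- The states of the simulation. -/
noncomputable def sim (k : ℕ) : ℕ × ∀ g : GCmd L, RegFile g := e.simStep^[k] (0, RegFile.fresh)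

theorem sim_succ (k : ℕ) : e.sim (k + 1) = e.simStep (e.sim k) :=
  Function.iterate_succ_apply' _ _ _

/-- All loaded registers belong to the running thread, and agree with the memory. -/
def SimInv (c : ℕ × ∀ g : GCmd L, RegFile g) : Prop :=
  ∀ g r v, c.2 g r = some v → g = e.sel c.1 ∧ v = e.st c.1 r.loc

open Classical in
theorem SimInv.simStep {c : ℕ × ∀ g : GCmd L, RegFile g} (hc : e.SimInv c) :
    e.SimInv (e.simStep c) := by
  intro g r v hv
  unfold OpExec.simStep at hv ⊢
  split_ifs at hv ⊢ with h
  · dsimp only at hv ⊢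
    by_cases hg : g = e.sel c.1
    · subst hg
      rw [Function.update_self] at hv
      refine ⟨rfl, ?_⟩
      by_cases hr : r = h.choose
      · subst hr
        rw [Function.update_self] at hv
        exact (Option.some.inj hv).symm
      · rw [Function.update_of_ne hr] at hv
        exact (hc _ _ _ hv).2
    · rw [Function.update_of_ne hg] at hv
      exact hc _ _ _ hv
  · dsimp only at hv
    by_cases hg : g = e.sel c.1
    · subst hg
      rw [Function.update_self] at hv
      cases hv
    · rw [Function.update_of_ne hg] at hv
      exact absurd (hc _ _ _ hv).1 hg

theorem simInv_sim (k : ℕ) : e.SimInv (e.sim k) := by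
  induction k with
  | zero =>
    intro g r v hv
    cases hv
  | succ k ih =>
    rw [sim_succ]
    exact SimInv.simStep e ih

open Classical in
theorem threadStep_simStep {c : ℕ × ∀ g : GCmd L, RegFile g} (hc : e.SimInv c) :
    ThreadStep (e.sel c.1) (e.st c.1) (e.st c.1, c.2 (e.sel c.1))
      (e.st (e.simStep c).1, (e.simStep c).2 (e.sel c.1)) := by
  unfold simStep
  split_ifs with h
  · dsimp only
    rw [Function.update_self]
    exact .load _ _ _ h.choose_spec
  · dsimp only
    rw [Function.update_self]
    refine .of_loaded _ (fun r => ?_) (e.step c.1)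
    obtain ⟨v, hv⟩ := Option.ne_none_iff_exists'.mp (not_exists.mp h r)
    rw [hv, (hc _ _ _ hv).2]

open Classical in
theorem simStep_frame (c : ℕ × ∀ g : GCmd L, RegFile g) {g : GCmd L} (hg : g ≠ e.sel c.1) :
    (e.simStep c).2 g = c.2 g := by
  unfold simStep
  split_ifs
  · exact Function.update_of_ne hg _ _
  · exact Function.update_of_ne hg _ _

/-- The load/store execution that simulates an operational execution. -/
noncomputable def toLSExec : LSExec G s₁ where
  mem k := e.st (e.sim k).1
  regs k := (e.sim k).2
  sel k := e.sel (e.sim k).1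
  view k := k
  mem_zero := e.init
  regs_zero _ := rfl
  sel_mem _ := e.sel_mem _
  view_le _ := le_rfl
  step k := by
    rw [sim_succ]
    exact e.threadStep_simStep (e.simInv_sim k)
  regs_frame k g hg := by
    rw [sim_succ]
    exact e.simStep_frame _ hg

theorem sim_fst_monotone : Monotone fun k => (e.sim k).1 := by
  refine monotone_nat_of_le_succ fun k => ?_
  rw [sim_succ]
  unfold simStep
  split_ifs
  · exact le_rfl
  · exact Nat.le_succ _

open Classical in
-- Each instruction that does not complete the iteration fills one of finitely many registers.
theorem exists_sim_fst_eq_succ (hG : ∀ g ∈ G, g.guards.Finite) (k : ℕ) :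
    ∃ k', k < k' ∧ (e.sim k').1 = (e.sim k).1 + 1 := by
  have := Reg.finite (hG _ (e.sel_mem (e.sim k).1))
  induction hc : ((e.sim k).2 (e.sel (e.sim k).1)).unloaded.ncard
    using Nat.strong_induction_on generalizing k with
  | _ c ih =>
    have hs := e.sim_succ k
    unfold simStep at hs
    split_ifs at hs with h
    · have h1 : (e.sim (k + 1)).1 = (e.sim k).1 := by rw [hs]
      have hlt : ((e.sim (k + 1)).2 (e.sel (e.sim (k + 1)).1)).unloaded.ncard < c := by
        rw [h1, hs, ← hc]
        dsimp only
        rw [Function.update_self]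
        exact Set.ncard_lt_ncard (RegFile.unloaded_update_ssubset h.choose_spec _) (Set.toFinite _)
      obtain ⟨k', hk', hk''⟩ := ih _ hlt (k + 1) (by rwa [h1]) rfl
      exact ⟨k', by omega, by rw [hk'', h1]⟩
    · exact ⟨k + 1, by omega, by rw [hs]⟩

/-- The bound `j ≤ k` transfers "infinitely often" from selections to instructions. -/
theorem exists_sim_fst_eq (hG : ∀ g ∈ G, g.guards.Finite) (j : ℕ) :
    ∃ k, j ≤ k ∧ (e.sim k).1 = j := by
  induction j with
  | zero => exact ⟨0, le_rfl, rfl⟩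
  | succ j ih =>
    obtain ⟨k, hk, h⟩ := ih
    obtain ⟨k', hk', h'⟩ := e.exists_sim_fst_eq_succ hG k
    exact ⟨k', by omega, by rw [h', h]⟩

theorem Fair.toLSExec {e : OpExec G s₁} (he : e.Fair) (hG : ∀ g ∈ G, g.guards.Finite) :
    e.toLSExec.Fair := by
  intro g hg i
  obtain ⟨j, hj, hsel⟩ := he g hg i
  obtain ⟨k, hk, h⟩ := e.exists_sim_fst_eq hG j
  refine ⟨k, by omega, ?_⟩
  change e.sel (e.sim k).1 = g
  rw [h, hsel]

theorem st_eq_of_isOpFixed {i : ℕ} (h : IsOpFixed G (e.st i)) {j : ℕ} (hij : i ≤ j) :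
    e.st j = e.st i := by
  induction j, hij using Nat.le_induction with
  | base => rfl
  | succ j _ ih =>
    rcases e.step j with hs | ⟨-, hs⟩
    · rw [ih] at hs
      exact h _ (e.sel_mem j) _ hs
    · rw [hs, ih]

theorem exists_settlesAbove_toLSExec (hG : ∀ g ∈ G, g.guards.Finite) {i : ℕ}
    (h : IsOpFixed G (e.st i)) : ∃ k, e.toLSExec.SettlesAbove (e.st i) k := by
  obtain ⟨k, -, hk⟩ := e.exists_sim_fst_eq hG i
  have hm : ∀ j, k ≤ j → e.toLSExec.mem j = e.st i := fun j hj =>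
    e.st_eq_of_isOpFixed h (hk.symm.le.trans (e.sim_fst_monotone hj))
  exact ⟨k, (hm k le_rfl).ge, fun j hj => (hm k le_rfl).trans (hm j hj.le).symm⟩

end OpExec

end

end PCCP

theorem mainTheorem6 {n : ℕ} {L : Fin n → Type*} [∀ i, Lattice (L i)]
    (P : PCCP.Proc L) (s₁ os : PCCP.Store L) (hos : PCCP.ReachesOpFix P s₁ os) :
    -- some execution, even one without outdated loads, reaches `os` and stays constant
    (∃ e : PCCP.LSExec (PCCP.gnf ∅ P) s₁, e.Interleaving ∧ e.EventuallyCoherent ∧ e.Fair ∧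
      ∃ i, e.SettlesAbove os i) ∧
    -- under the ascending chain condition between `s₁` and `os`, every execution does
    ((∀ x, WellFoundedGT (Set.Icc (s₁ x) (os x))) →
      ∀ e : PCCP.LSExec (PCCP.gnf ∅ P) s₁, e.EventuallyCoherent → e.Fair →
        ∃ i, e.SettlesAbove os i) ∧
    -- with soundness, the final store is exactly `os`
    (∀ e : PCCP.LSExec (PCCP.gnf ∅ P) s₁, (∀ i, e.mem i ≤ os) ∧
      ∀ i, e.SettlesAbove os i → ∀ j, i ≤ j → e.mem j = os) := by
  obtain ⟨o, hfair, k, rfl, hfix⟩ := hos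
  have hG : ∀ g ∈ PCCP.gnf ∅ P, g.guards.Finite := fun g hg =>
    PCCP.finite_guards_of_mem_gnf Set.finite_empty hg
  have hle : s₁ ≤ o.st k := o.init_le k
  refine ⟨⟨o.toLSExec, fun _ => rfl, fun T => ⟨T, fun _ h => h⟩, hfair.toLSExec hG,
    o.exists_settlesAbove_toLSExec hG hfix⟩, fun hwf e hec hef => ?_, fun e => ?_⟩
  · obtain ⟨K, hK⟩ := e.eventually_constant hle hfix hwf hec
    -- The operational execution stays below any fixed point above `s₁`, in particular below the
    -- final memory.
    exact ⟨K, o.le_of_isOpFixed (e.mem_mem_Icc hle hfix K).1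
      (e.isOpFixed_of_constant hG hec hef hK) k, fun j hj => (hK j hj.le).symm⟩
  · have hmem := fun i => (e.mem_mem_Icc hle hfix i).2
    refine ⟨hmem, fun i hi j hij => ?_⟩
    have h : e.mem i = o.st k := le_antisymm (hmem i) hi.1
    rcases hij.eq_or_lt with rfl | hij
    · exact h
    · rw [← hi.2 j hij, h]
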